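/- For a tuple $\mathbf{k}=(k_1,\ldots,k_r)$ of positive integers (an index of depth $r$ and weight $k_1+\cdots+k_r$) let $$\mathrm{Li}_{\mathbf{k}}(z)=\sum_{0<m_1<\cdots<m_r}\frac{z^{m_r}}{m_1^{k_1}\cdots m_r^{k_r}}\quad(0\le z<1),\qquad \zeta(\mathbf{k})=\sum_{0<m_1<\cdots<m_r}\frac{1}{m_1^{k_1}\cdots m_r^{k_r}}\quad(k_r>1).$$ The shuffle-regularized polynomial $Z_{\mathbf{k}}(T)\in\mathbb{R}[T]$ is the polynomial such that, for some $\varepsilon>0$, $$\mathrm{Li}_{\mathbf{k}}(z)=Z_{\mathbf{k}}(-\log(1-z))+O((1-z)^{\varepsilon})\quad\text{as } z\to1^-,$$ and the shuffle-regularized value is $\zeta^{\mathrm{sh}}(\mathbf{k})=Z_{\mathbf{k}}(0)$. Theorem. Let $r,k\ge1$ be integers. The series for $\zeta(\underbrace{1,\ldots,1}_{r-1},k+1)$ converges; for every index $\mathbf{k}$ of weight $r+k$ and depth $r$ (convergent or not), the series $\mathrm{Li}_{\mathbf{k}}(z)$ converges for $0\le z<1$ and the polynomial $Z_{\mathbf{k}}$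 exists and is unique; and $$\sum_{\substack{k_1+\cdots+k_r=r+k\\ k_1,\ldots,k_r\ge1}}\zeta^{\mathrm{sh}}(k_1,\ldots,k_r)=(-1)^{r-1}\,\zeta(\underbrace{1,\ldots,1}_{r-1},k+1).$$ -/

import Mathlib

open Polynomial

namespace MZV

/-- The summation range `0 < m₁ < ⋯ < m_r`. -/
abbrev Chain (r : ℕ) : Type := {m : Fin r → ℕ // StrictMono m ∧ ∀ i, 0 < m i}

/-- The outermost (largest) summation variable `m_r` of a chain; see `top_eq_last`. -/
def Chain.top {r : ℕ} (m : Chain r) : ℕ := Finset.univ.sup m.1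

theorem Chain.top_eq_last {r : ℕ} (m : Chain (r + 1)) : m.top = m.1 (Fin.last r) :=
  le_antisymm (Finset.sup_le fun i _ => m.2.1.monotone (Fin.le_last i))
    (Finset.le_sup (f := m.1) (Finset.mem_univ _))

/-- The summand `1 / (m₁^{κ₁} ⋯ m_r^{κ_r})` of the multiple zeta value. -/
noncomputable def zetaTerm {r : ℕ} (κ : Fin r → ℕ) (m : Chain r) : ℝ :=
  1 / ∏ i, (m.1 i : ℝ) ^ κ i

/-- The multiple zeta value `ζ(κ₁, …, κ_r)`, for `κ_r > 1`. -/
noncomputable def zeta {r : ℕ} (κ : Fin r → ℕ) : ℝ := ∑' m : Chain r, zetaTerm κ m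

/-- The summand `z^{m_r} / (m₁^{κ₁} ⋯ m_r^{κ_r})` of the multiple polylogarithm. -/
noncomputable def liTerm {r : ℕ} (κ : Fin r → ℕ) (z : ℝ) (m : Chain r) : ℝ :=
  z ^ m.top / ∏ i, (m.1 i : ℝ) ^ κ i

/-- The multiple polylogarithm `Li_{κ₁, …, κ_r}(z)`, for real `0 ≤ z < 1`. -/
noncomputable def Li {r : ℕ} (κ : Fin r → ℕ) (z : ℝ) : ℝ := ∑' m : Chain r, liTerm κ z m

/-- `P` is a shuffle-regularized polynomial of `κ`:
`Li_κ(z) = P(-log(1-z)) + O((1-z)^ε)` as `z → 1⁻`, for some `ε > 0`. -/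
def IsShuffleRegPoly {r : ℕ} (κ : Fin r → ℕ) (P : ℝ[X]) : Prop :=
  ∃ ε : ℝ, 0 < ε ∧
    (fun z : ℝ => Li κ z - P.eval (-Real.log (1 - z)))
      =O[nhdsWithin 1 (Set.Iio 1)] (fun z : ℝ => (1 - z) ^ ε)

open Classical in
/-- The shuffle-regularized polynomial `Z_κ(T)`, the one characterized by `IsShuffleRegPoly`. -/
noncomputable def shufflePoly {r : ℕ} (κ : Fin r → ℕ) : ℝ[X] :=
  if h : ∃ P : ℝ[X], IsShuffleRegPoly κ P then h.choose else 0

/-- The shuffle-regularized value: the constant term of the shuffle-regularized polynomial. -/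
noncomputable def zetaSh {r : ℕ} (κ : Fin r → ℕ) : ℝ := (shufflePoly κ).eval 0

/-- All indices (tuples of positive integers) of depth `r` and weight `w`. -/
def indices (r w : ℕ) : Finset (Fin r → ℕ) :=
  (Finset.piAntidiag Finset.univ w).filter fun κ => ∀ i, 0 < κ i

theorem mem_indices {r w : ℕ} {κ : Fin r → ℕ} :
    κ ∈ indices r w ↔ ∑ i, κ i = w ∧ ∀ i, 0 < κ i := by
  simp [indices]

/-- The index `(1, …, 1, k + 1)` of depth `r`, with `r - 1` ones. -/
def heightOne (r k : ℕ) : Fin r → ℕ := fun i => if (i : ℕ) + 1 = r then k + 1 else 1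

end MZV

/-!
Write `L = -log(1 - z)`. Differentiating the series term by term gives `z Li_{κ, l+1}' = Li_{κ, l}`
(`hasDerivAt_Li_snoc`), where the exponent `0` is allowed and
`Li_{κ, 0} = z / (1 - z) · Li_κ` (`Li_snoc_zero`): summing the largest variable freely gives a
geometric series.

Existence of the regularized polynomial is an induction on the depth and then on the last exponent:
integrating an expansion `P(L) + O((1-z)^ε)` against `dz / (1 - z) = dL` gives another one, and
against `dz / z` gives a constant plus `O((1-z)^(1/2))`. In the second case monotone and dominated
convergence identify the constant with the value `ζ` of the series at `1`. Uniqueness holds because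
a polynomial which tends to `0` at infinity vanishes.

The sum formula is the constant term of the identity, valid on `[0, 1)`,
`∑_κ Li_κ(z) = ∑_{j < r} (-1)^j L^(r-1-j) / (r-1-j)! · Li_{1, …, 1, k+1}(z)`
with `κ` of depth `r` and weight `r + k` and with `j` ones in the `j`-th term
(`sumLi_eq_altSumLi`). Both sides `F_{r,k}` vanish at `0` and satisfy
`F_{r,k}' = F_{r-1,k} / (1 - z) + F_{r,k-1} / z`; for `k = 0` both equal `L^r / r!`. For `k ≥ 1`
each polylogarithm on the right is `ζ(1, …, 1, k+1) + O((1-z)^ε)`, so only `j = r - 1` contributes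
to the constant term.
-/

open Filter Topology Asymptotics Set

namespace MZV

/-! ### Chains -/

theorem Chain.le_top {r : ℕ} (m : Chain r) (i : Fin r) : m.1 i ≤ m.top :=
  Finset.le_sup (f := m.1) (Finset.mem_univ i)

theorem Chain.top_pos {r : ℕ} (m : Chain (r + 1)) : 0 < m.top := by
  rw [m.top_eq_last]
  exact m.2.2 _

/-- The chain `0 < m₁ < ⋯ < m_r < n`. -/
def Chain.snoc {r : ℕ} (m : Chain r) (n : ℕ) (h : m.top < n) : Chain (r + 1) :=
  ⟨Fin.snoc m.1 n, by
    constructor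
    · rw [Fin.strictMono_iff_lt_succ]
      cases r with
      | zero => exact fun i => i.elim0
      | succ r =>
        intro i
        induction i using Fin.lastCases with
        | last =>
          rw [Fin.succ_last, Fin.snoc_last, Fin.snoc_castSucc]
          exact (m.le_top _).trans_lt h
        | cast i =>
          rw [Fin.succ_castSucc, Fin.snoc_castSucc, Fin.snoc_castSucc]
          exact m.2.1 Fin.castSucc_lt_succ
    · intro i
      induction i using Fin.lastCases with
      | last => rw [Fin.snoc_last]; exact h.pos
      | cast i => rw [Fin.snoc_castSucc]; exact m.2.2 i⟩

/-- The chain `0 < m₁ < ⋯ < m_r` obtained by dropping the largest entry. -/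
def Chain.init {r : ℕ} (m : Chain (r + 1)) : Chain r :=
  ⟨fun i => m.1 i.castSucc, fun _ _ h => m.2.1 (Fin.castSucc_lt_castSucc_iff.2 h),
    fun _ => m.2.2 _⟩

theorem Chain.top_init_lt {r : ℕ} (m : Chain (r + 1)) : m.init.top < m.top := by
  rw [Chain.top, Finset.sup_lt_iff (by simpa using m.top_pos)]
  intro i _
  rw [m.top_eq_last]
  exact m.2.1 (Fin.castSucc_lt_last i)

theorem Chain.top_snoc {r : ℕ} (m : Chain r) (n : ℕ) (h : m.top < n) : (m.snoc n h).top = n := by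
  rw [Chain.top_eq_last]
  simp [Chain.snoc]

theorem Chain.init_snoc {r : ℕ} (m : Chain r) (n : ℕ) (h : m.top < n) :
    (m.snoc n h).init = m := by
  apply Subtype.ext
  funext i
  simp [Chain.snoc, Chain.init]

theorem Chain.snoc_init {r : ℕ} (m : Chain (r + 1)) :
    m.init.snoc m.top m.top_init_lt = m := by
  apply Subtype.ext
  funext i
  induction i using Fin.lastCases with
  | last => simp [Chain.snoc, m.top_eq_last]
  | cast i => simp [Chain.snoc, Chain.init]

/-- A chain of length `r + 1` is a chain of length `r` together with the gap between its largest
entry and the new one. -/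
def chainEquiv (r : ℕ) : Chain r × ℕ ≃ Chain (r + 1) where
  toFun p := p.1.snoc (p.1.top + 1 + p.2) (by omega)
  invFun m := (m.init, m.top - (m.init.top + 1))
  left_inv p := by
    ext1
    · exact Chain.init_snoc ..
    · simp [Chain.init_snoc, Chain.top_snoc]
  right_inv m := by
    have h := m.top_init_lt
    have h' : m.init.top + 1 + (m.top - (m.init.top + 1)) = m.top := by omega
    simp only [h']
    exact m.snoc_init

/-! ### Polylogarithms with one more argument -/

theorem liTerm_snoc {r : ℕ} (κ : Fin r → ℕ) (l : ℕ) (z : ℝ) (m : Chain (r + 1)) :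
    liTerm (Fin.snoc κ l : Fin (r + 1) → ℕ) z m =
      z ^ m.top / ((∏ i, (m.init.1 i : ℝ) ^ κ i) * (m.top : ℝ) ^ l) := by
  rw [liTerm, Fin.prod_univ_castSucc]
  simp [Chain.init, m.top_eq_last]

theorem liTerm_snoc_zero {r : ℕ} (κ : Fin r → ℕ) (z : ℝ) (p : Chain r × ℕ) :
    liTerm (Fin.snoc κ 0 : Fin (r + 1) → ℕ) z (chainEquiv r p) =
      liTerm κ z p.1 * (z * z ^ p.2) := by
  rw [liTerm_snoc, liTerm]
  simp only [chainEquiv, Equiv.coe_fn_mk, Chain.top_snoc, Chain.init_snoc]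
  rw [pow_zero, mul_one, pow_add, pow_add]
  ring

theorem liTerm_snoc_succ {r : ℕ} (κ : Fin r → ℕ) (l : ℕ) (z : ℝ) (m : Chain (r + 1)) :
    m.top * liTerm (Fin.snoc κ (l + 1) : Fin (r + 1) → ℕ) z m =
      liTerm (Fin.snoc κ l : Fin (r + 1) → ℕ) z m := by
  have h : (m.top : ℝ) ≠ 0 := by exact_mod_cast m.top_pos.ne'
  rw [liTerm_snoc, liTerm_snoc, pow_succ, ← mul_assoc, ← div_div, mul_div_cancel₀ _ h]

theorem liTerm_nonneg {r : ℕ} (κ : Fin r → ℕ) {z : ℝ} (hz : 0 ≤ z) (m : Chain r) :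
    0 ≤ liTerm κ z m := by
  unfold liTerm
  positivity

theorem liTerm_mono {r : ℕ} (κ : Fin r → ℕ) {y z : ℝ} (hy : 0 ≤ y) (hyz : y ≤ z) (m : Chain r) :
    liTerm κ y m ≤ liTerm κ z m := by
  unfold liTerm
  gcongr

theorem liTerm_one {r : ℕ} (κ : Fin r → ℕ) (m : Chain r) : liTerm κ 1 m = zetaTerm κ m := by
  simp [liTerm, zetaTerm]

theorem liTerm_le_liTerm_zero {r : ℕ} (κ : Fin r → ℕ) {z : ℝ} (hz : 0 ≤ z) (m : Chain r) :
    liTerm κ z m ≤ liTerm (fun _ => 0) z m := by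
  simp only [liTerm, pow_zero, Finset.prod_const_one, div_one]
  apply div_le_self (by positivity)
  exact_mod_cast Finset.one_le_prod' fun i _ => Nat.one_le_pow _ _ (m.2.2 i)

/-- With all exponents zero the series is a power of the geometric series `z / (1 - z)`, and it
dominates all the others. -/
theorem summable_liTerm {r : ℕ} (κ : Fin r → ℕ) {z : ℝ} (hz : 0 ≤ z) (hz1 : z < 1) :
    Summable (liTerm κ z) := by
  suffices h : Summable (liTerm (fun _ : Fin r => 0) z) from
    h.of_nonneg_of_le (liTerm_nonneg κ hz) (liTerm_le_liTerm_zero κ hz)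
  clear κ
  induction r with
  | zero => exact Summable.of_finite
  | succ r ih =>
    have h0 : (fun _ : Fin (r + 1) => 0) = (Fin.snoc (fun _ : Fin r => 0) 0 : Fin (r + 1) → ℕ) := by
      funext i
      induction i using Fin.lastCases <;> simp
    rw [h0, ← (chainEquiv r).summable_iff]
    refine (ih.mul_of_nonneg ((summable_geometric_of_lt_one hz hz1).mul_left z)
      (liTerm_nonneg _ hz) fun n => by positivity).congr fun p => ?_
    exact (liTerm_snoc_zero _ z p).symm

theorem Li_snoc_zero {r : ℕ} (κ : Fin r → ℕ) {z : ℝ} (hz : 0 ≤ z) (hz1 : z < 1) :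
    Li (Fin.snoc κ 0 : Fin (r + 1) → ℕ) z = z / (1 - z) * Li κ z := by
  have hg := (summable_geometric_of_lt_one hz hz1).mul_left z
  have hs := summable_liTerm κ hz hz1
  rw [Li, ← (chainEquiv r).tsum_eq]
  simp only [liTerm_snoc_zero]
  rw [← hs.tsum_mul_tsum hg (hs.mul_of_nonneg hg (liTerm_nonneg _ hz) fun n => by positivity),
    tsum_mul_left, tsum_geometric_of_lt_one hz hz1, ← Li]
  ring

theorem Li_depth_zero (κ : Fin 0 → ℕ) (z : ℝ) : Li κ z = 1 := by
  have : Unique (Chain 0) :=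
    { default := ⟨Fin.elim0, fun i => i.elim0, fun i => i.elim0⟩
      uniq := fun m => Subtype.ext (Subsingleton.elim _ _) }
  rw [Li, tsum_fintype, Fintype.sum_unique]
  simp [liTerm, Chain.top]

theorem Li_zero {r : ℕ} (κ : Fin (r + 1) → ℕ) : Li κ 0 = 0 := by
  simp [Li, liTerm, (Chain.top_pos _).ne']

theorem continuousOn_Li {r : ℕ} (κ : Fin r → ℕ) {b : ℝ} (hb : b < 1) :
    ContinuousOn (Li κ) (Icc 0 b) := by
  rcases lt_or_ge b 0 with h | h
  · simp [Icc_eq_empty_of_lt h]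
  refine continuousOn_tsum (u := liTerm κ b) (fun m => ?_) (summable_liTerm κ h hb) ?_
  · unfold liTerm
    fun_prop
  · intro m x hx
    rw [Real.norm_of_nonneg (liTerm_nonneg κ hx.1 m)]
    exact liTerm_mono κ hx.1 hx.2 m

/-- The exponent `0` is allowed on the right; see `Li_snoc_zero`. -/
theorem hasDerivAt_Li_snoc {r : ℕ} (κ : Fin r → ℕ) (l : ℕ) {z : ℝ} (hz : 0 < z) (hz1 : z < 1) :
    HasDerivAt (Li (Fin.snoc κ (l + 1) : Fin (r + 1) → ℕ))
      (Li (Fin.snoc κ l : Fin (r + 1) → ℕ) z / z) z := by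
  obtain ⟨a, ha, haz⟩ := exists_between hz
  obtain ⟨b, hzb, hb⟩ := exists_between hz1
  have key := hasDerivAt_tsum_of_isPreconnected (t := Ioo a b) (y₀ := z) (y := z)
    (g := fun m y => liTerm (Fin.snoc κ (l + 1) : Fin (r + 1) → ℕ) y m)
    (g' := fun m y => liTerm (Fin.snoc κ l : Fin (r + 1) → ℕ) y m / y)
    (u := fun m => liTerm (Fin.snoc κ l : Fin (r + 1) → ℕ) b m / a)
    ((summable_liTerm _ (hz.trans hzb).le hb).div_const a) isOpen_Ioo isPreconnected_Ioo
    ?_ ?_ ⟨haz, hzb⟩ (summable_liTerm _ hz.le hz1) ⟨haz, hzb⟩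
  · rwa [tsum_div_const] at key
  · intro m y hy
    have hy0 : y ≠ 0 := (ha.trans hy.1).ne'
    have h := (hasDerivAt_pow m.top y).div_const
      (∏ i, (m.1 i : ℝ) ^ (Fin.snoc κ (l + 1) : Fin (r + 1) → ℕ) i)
    refine h.congr_deriv ?_
    rw [← liTerm_snoc_succ, liTerm, ← pow_sub_one_mul m.top_pos.ne' y]
    field_simp
  · intro m y hy
    have hy0 : 0 < y := ha.trans hy.1
    rw [Real.norm_of_nonneg (div_nonneg (liTerm_nonneg _ hy0.le m) hy0.le)]
    exact div_le_div₀ (liTerm_nonneg _ (hy0.trans hy.2).le m) (liTerm_mono _ hy0.le hy.2.le m) ha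
      hy.1.le

theorem hasDerivAt_Li_snoc_one {r : ℕ} (κ : Fin r → ℕ) {z : ℝ} (hz : 0 < z) (hz1 : z < 1) :
    HasDerivAt (Li (Fin.snoc κ 1 : Fin (r + 1) → ℕ)) (Li κ z / (1 - z)) z := by
  have h := hasDerivAt_Li_snoc κ 0 hz hz1
  rw [Li_snoc_zero κ hz.le hz1] at h
  refine h.congr_deriv ?_
  have : 1 - z ≠ 0 := by linarith
  field_simp

theorem hasDerivAt_neg_log_one_sub {z : ℝ} (hz1 : z < 1) :
    HasDerivAt (fun z : ℝ => -Real.log (1 - z)) (1 / (1 - z)) z := by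
  refine (((hasDerivAt_id' z).const_sub 1).log (by linarith)).fun_neg.congr_deriv ?_
  rw [neg_div, neg_neg]

/-! ### Logarithmic asymptotics at `1` -/

/-- `f(z) = P(-log(1-z)) + O((1-z)^ε)` as `z → 1⁻` for some `ε > 0`; for `f = Li κ` this is
`IsShuffleRegPoly κ P`. -/
def HasLogExpansion (f : ℝ → ℝ) (P : ℝ[X]) : Prop :=
  ∃ ε : ℝ, 0 < ε ∧
    (fun z : ℝ => f z - P.eval (-Real.log (1 - z))) =O[𝓝[<] 1] (fun z : ℝ => (1 - z) ^ ε)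

theorem eventually_mem_Ioo : ∀ᶠ z in 𝓝[<] (1 : ℝ), z ∈ Ioo (0 : ℝ) 1 :=
  Ioo_mem_nhdsLT one_pos

theorem tendsto_neg_log_one_sub :
    Tendsto (fun z : ℝ => -Real.log (1 - z)) (𝓝[<] 1) atTop := by
  refine tendsto_neg_atBot_atTop.comp (Real.tendsto_log_nhdsGT_zero.comp ?_)
  refine tendsto_nhdsWithin_iff.2 ⟨?_, eventually_mem_Ioo.mono fun z hz => sub_pos.2 hz.2⟩
  refine Tendsto.mono_left ?_ nhdsWithin_le_nhds
  exact (continuous_const.sub continuous_id).tendsto' 1 0 (by simp)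

theorem isBigO_rpow_of_le {a b : ℝ} (hab : a ≤ b) :
    (fun z : ℝ => (1 - z) ^ b) =O[𝓝[<] 1] fun z : ℝ => (1 - z) ^ a := by
  refine IsBigO.of_bound 1 (eventually_mem_Ioo.mono fun z hz => ?_)
  have h : 0 < 1 - z := sub_pos.2 hz.2
  rw [Real.norm_of_nonneg (by positivity), Real.norm_of_nonneg (by positivity), one_mul]
  exact Real.rpow_le_rpow_of_exponent_ge h (by linarith [hz.1]) hab

theorem tendsto_one_sub_rpow {ε : ℝ} (hε : 0 < ε) :
    Tendsto (fun z : ℝ => (1 - z) ^ ε) (𝓝[<] 1) (𝓝 0) := by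
  refine Tendsto.mono_left ?_ nhdsWithin_le_nhds
  refine ((continuous_const.sub continuous_id).rpow_const fun _ => Or.inr hε.le).tendsto' 1 0 ?_
  simp [Real.zero_rpow hε.ne']

/-- Polynomials in the logarithm grow slower than any negative power of `1 - z`. -/
theorem isBigO_eval_neg_log (P : ℝ[X]) {δ : ℝ} (hδ : 0 < δ) :
    (fun z : ℝ => P.eval (-Real.log (1 - z))) =O[𝓝[<] 1] fun z : ℝ => (1 - z) ^ (-δ) := by
  have h1 := ((P.comp (C δ⁻¹ * X)).tendsto_div_exp_atTop).comp
    (tendsto_neg_log_one_sub.const_mul_atTop hδ)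
  refine (isLittleO_of_tendsto' ?_ (h1.congr' ?_)).isBigO
  · refine eventually_mem_Ioo.mono fun z hz h => ?_
    exact absurd h (Real.rpow_pos_of_pos (sub_pos.2 hz.2) _).ne'
  · refine eventually_mem_Ioo.mono fun z hz => ?_
    simp only [Function.comp, eval_comp, eval_mul, eval_C, eval_X]
    rw [Real.rpow_def_of_pos (sub_pos.2 hz.2), inv_mul_cancel_left₀ hδ.ne']
    ring_nf

theorem HasLogExpansion.unique {f : ℝ → ℝ} {P Q : ℝ[X]} (hP : HasLogExpansion f P)
    (hQ : HasLogExpansion f Q) : P = Q := by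
  obtain ⟨ε, hε, hP⟩ := hP
  obtain ⟨δ, hδ, hQ⟩ := hQ
  have h := (hQ.trans_tendsto (tendsto_one_sub_rpow hδ)).sub
    (hP.trans_tendsto (tendsto_one_sub_rpow hε))
  have h' : Tendsto (fun z : ℝ => (P - Q).eval (-Real.log (1 - z))) (𝓝[<] 1) (𝓝 0) := by
    refine (h.congr fun z => ?_).trans (by simp)
    simp
  have hexp : Tendsto (fun x : ℝ => 1 - Real.exp (-x)) atTop (𝓝[<] 1) := by
    refine tendsto_nhdsWithin_iff.2 ⟨?_, Eventually.of_forall fun x => ?_⟩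
    · simpa using (Real.tendsto_exp_neg_atTop_nhds_zero).const_sub 1
    · simpa using Real.exp_pos _
  have h2 : Tendsto (fun x => (P - Q).eval x) atTop (𝓝 0) := by
    refine (h'.comp hexp).congr fun x => ?_
    simp
  have h3 := ((P - Q).tendsto_nhds_iff.1 h2).1
  exact sub_eq_zero.1 (leadingCoeff_eq_zero.1 h3)

theorem HasLogExpansion.add {f g : ℝ → ℝ} {P Q : ℝ[X]} (hP : HasLogExpansion f P)
    (hQ : HasLogExpansion g Q) : HasLogExpansion (fun z => f z + g z) (P + Q) := by
  obtain ⟨ε, hε, hP⟩ := hP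
  obtain ⟨δ, hδ, hQ⟩ := hQ
  refine ⟨min ε δ, lt_min hε hδ, ?_⟩
  refine ((hP.trans (isBigO_rpow_of_le (min_le_left ..))).add
    (hQ.trans (isBigO_rpow_of_le (min_le_right ..)))).congr_left fun z => ?_
  rw [eval_add]
  ring

theorem HasLogExpansion.sum {ι : Type*} (s : Finset ι) {f : ι → ℝ → ℝ} {P : ι → ℝ[X]}
    (h : ∀ i ∈ s, HasLogExpansion (f i) (P i)) :
    HasLogExpansion (fun z => ∑ i ∈ s, f i z) (∑ i ∈ s, P i) := by
  classical
  induction s using Finset.induction_on with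
  | empty => exact ⟨1, one_pos, by simpa using isBigO_zero _ _⟩
  | insert i s hi ih =>
    simp only [Finset.sum_insert hi]
    exact (h i (Finset.mem_insert_self ..)).add
      (ih fun j hj => h j (Finset.mem_insert_of_mem hj))

theorem HasLogExpansion.eval_mul {f : ℝ → ℝ} {P : ℝ[X]} (hP : HasLogExpansion f P) (Q : ℝ[X]) :
    HasLogExpansion (fun z => Q.eval (-Real.log (1 - z)) * f z) (Q * P) := by
  obtain ⟨ε, hε, hP⟩ := hP
  refine ⟨ε / 2, half_pos hε, ?_⟩
  refine ((isBigO_eval_neg_log Q (half_pos hε)).mul hP).congr' ?_ ?_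
  · refine Eventually.of_forall fun z => ?_
    simp only [Polynomial.eval_mul]
    ring
  · refine eventually_mem_Ioo.mono fun z hz => ?_
    simp only
    rw [← Real.rpow_add (sub_pos.2 hz.2)]
    ring_nf

theorem HasLogExpansion.congr {f g : ℝ → ℝ} {P : ℝ[X]} (hP : HasLogExpansion f P)
    (h : ∀ z ∈ Ioo (0 : ℝ) 1, f z = g z) : HasLogExpansion g P := by
  obtain ⟨ε, hε, hP⟩ := hP
  refine ⟨ε, hε, hP.congr' (eventually_mem_Ioo.mono fun z hz => ?_) EventuallyEq.rfl⟩
  simp only [h z hz]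

theorem HasLogExpansion.isBigO {f : ℝ → ℝ} {P : ℝ[X]} (hP : HasLogExpansion f P) {δ : ℝ}
    (hδ : 0 < δ) : f =O[𝓝[<] 1] fun z : ℝ => (1 - z) ^ (-δ) := by
  obtain ⟨ε, hε, hP⟩ := hP
  refine ((hP.trans (isBigO_rpow_of_le (by linarith))).add
    (isBigO_eval_neg_log P hδ)).congr_left fun z => ?_
  ring

/-- Integration of the bound `h' = O((1-z)^(ε-1))`. No integrals are needed: `h` plus or minus
`(C / ε) (1-z)^ε` is monotone. -/
theorem exists_isBigO_sub_const {h h' : ℝ → ℝ} {ε : ℝ} (hε : 0 < ε)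
    (hd : ∀ z ∈ Ioo (0 : ℝ) 1, HasDerivAt h (h' z) z)
    (hO : h' =O[𝓝[<] 1] fun z : ℝ => (1 - z) ^ (ε - 1)) :
    ∃ c, (fun z => h z - c) =O[𝓝[<] 1] fun z : ℝ => (1 - z) ^ ε := by
  obtain ⟨K, hK0, hK⟩ := hO.exists_pos
  obtain ⟨b, hb, hbd⟩ := (mem_nhdsLT_iff_exists_Ioo_subset' (zero_lt_one' ℝ)).1
    (hK.bound.and eventually_mem_Ioo)
  rw [mem_Iio] at hb
  set w : ℝ → ℝ := fun z => K / ε * (1 - z) ^ ε with hw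
  have hw0 : ∀ z ∈ Ioo b 1, 0 ≤ w z := fun z hz => by
    have := sub_pos.2 hz.2
    positivity
  have hwd : ∀ z ∈ Ioo b 1, HasDerivAt w (-(K * (1 - z) ^ (ε - 1))) z := fun z hz => by
    refine ((((hasDerivAt_id' z).const_sub 1).rpow_const
      (Or.inl (sub_pos.2 hz.2).ne')).const_mul (K / ε)).congr_deriv ?_
    field_simp
  have hbound : ∀ z ∈ Ioo b 1, |h' z| ≤ K * (1 - z) ^ (ε - 1) := fun z hz => by
    have := (hbd hz).1
    rwa [Real.norm_eq_abs, Real.norm_of_nonneg (Real.rpow_nonneg (sub_pos.2 hz.2).le _)] at this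
  have hmono : MonotoneOn (fun z => h z - w z) (Ioo b 1) := by
    have hD : ∀ z ∈ Ioo b 1, HasDerivAt (fun z => h z - w z)
        (h' z - -(K * (1 - z) ^ (ε - 1))) z := fun z hz => (hd z (hbd hz).2).sub (hwd z hz)
    refine monotoneOn_of_deriv_nonneg (convex_Ioo b 1)
      (fun z hz => (hD z hz).continuousAt.continuousWithinAt) ?_ ?_
    · rw [interior_Ioo]
      exact fun z hz => (hD z hz).differentiableAt.differentiableWithinAt
    · rw [interior_Ioo]
      intro z hz
      rw [(hD z hz).deriv]
      linarith [neg_abs_le (h' z), hbound z hz]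
  have hanti : AntitoneOn (fun z => h z + w z) (Ioo b 1) := by
    have hD : ∀ z ∈ Ioo b 1, HasDerivAt (fun z => h z + w z)
        (h' z + -(K * (1 - z) ^ (ε - 1))) z := fun z hz => (hd z (hbd hz).2).add (hwd z hz)
    refine antitoneOn_of_deriv_nonpos (convex_Ioo b 1)
      (fun z hz => (hD z hz).continuousAt.continuousWithinAt) ?_ ?_
    · rw [interior_Ioo]
      exact fun z hz => (hD z hz).differentiableAt.differentiableWithinAt
    · rw [interior_Ioo]
      intro z hz
      rw [(hD z hz).deriv]
      linarith [le_abs_self (h' z), hbound z hz]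
  have hcross : ∀ x ∈ Ioo b 1, ∀ y ∈ Ioo b 1, h y - w y ≤ h x + w x := fun x hx y hy => by
    rcases le_total y x with hyx | hxy
    · have := hmono hy hx hyx
      simp only at this
      linarith [hw0 x hx]
    · have := hanti hx hy hxy
      simp only at this
      linarith [hw0 y hy]
  refine ⟨sSup ((fun z => h z - w z) '' Ioo b 1), IsBigO.of_bound (K / ε) ?_⟩
  filter_upwards [Ioo_mem_nhdsLT hb] with x hx
  rw [Real.norm_of_nonneg (Real.rpow_nonneg (sub_pos.2 hx.2).le _), Real.norm_eq_abs, abs_le]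
  constructor
  · have : sSup ((fun z => h z - w z) '' Ioo b 1) ≤ h x + w x := by
      refine csSup_le ⟨_, mem_image_of_mem _ hx⟩ ?_
      rintro _ ⟨y, hy, rfl⟩
      exact hcross x hx y hy
    linarith
  · have : h x - w x ≤ sSup ((fun z => h z - w z) '' Ioo b 1) := by
      refine le_csSup ⟨h x + w x, ?_⟩ (mem_image_of_mem _ hx)
      rintro _ ⟨y, hy, rfl⟩
      exact hcross x hx y hy
    linarith

theorem exists_derivative_eq (P : ℝ[X]) : ∃ Q : ℝ[X], derivative Q = P := by
  induction P using Polynomial.induction_on' with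
  | add p q hp hq =>
    obtain ⟨P, rfl⟩ := hp
    obtain ⟨Q, rfl⟩ := hq
    exact ⟨P + Q, derivative_add⟩
  | monomial n a =>
    refine ⟨monomial (n + 1) (a / (n + 1)), ?_⟩
    have : (n : ℝ) + 1 ≠ 0 := by positivity
    rw [derivative_monomial]
    simp [this]

/-- Integration against `dz / (1 - z) = d(-log(1 - z))`. -/
theorem HasLogExpansion.exists_of_deriv_div_one_sub {f g : ℝ → ℝ} {P : ℝ[X]}
    (hg : HasLogExpansion g P) (hd : ∀ z ∈ Ioo (0 : ℝ) 1, HasDerivAt f (g z / (1 - z)) z) :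
    ∃ Q, HasLogExpansion f Q := by
  obtain ⟨ε, hε, hO⟩ := hg
  obtain ⟨Q, rfl⟩ := exists_derivative_eq P
  have hD : ∀ z ∈ Ioo (0 : ℝ) 1, HasDerivAt (fun z => f z - Q.eval (-Real.log (1 - z)))
      ((g z - (derivative Q).eval (-Real.log (1 - z))) * (1 - z) ^ (-1 : ℝ)) z := fun z hz => by
    have h1 := (Q.hasDerivAt (-Real.log (1 - z))).comp z (hasDerivAt_neg_log_one_sub hz.2)
    refine ((hd z hz).sub h1).congr_deriv ?_
    rw [Real.rpow_neg_one]
    ring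
  obtain ⟨c, hc⟩ := exists_isBigO_sub_const hε hD <|
    (hO.mul (isBigO_refl (fun z : ℝ => (1 - z) ^ (-1 : ℝ)) _)).congr' EventuallyEq.rfl
      (eventually_mem_Ioo.mono fun z hz => by
        simp only
        rw [← Real.rpow_add (sub_pos.2 hz.2), sub_eq_add_neg ε])
  refine ⟨Q + C c, ε, hε, hc.congr_left fun z => ?_⟩
  simp only [eval_add, eval_C]
  ring

/-- Integration against `dz / z`: the singularity at `1` disappears. -/
theorem HasLogExpansion.exists_const_of_deriv_div {f g : ℝ → ℝ} {P : ℝ[X]}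
    (hg : HasLogExpansion g P) (hd : ∀ z ∈ Ioo (0 : ℝ) 1, HasDerivAt f (g z / z) z) :
    ∃ c, HasLogExpansion f (C c) := by
  have hz : (fun z : ℝ => z⁻¹) =O[𝓝[<] 1] fun _ => (1 : ℝ) := by
    have : Tendsto (fun z : ℝ => z⁻¹) (𝓝[<] 1) (𝓝 1⁻¹) :=
      (tendsto_inv₀ one_ne_zero).mono_left nhdsWithin_le_nhds
    exact this.isBigO_one ℝ
  obtain ⟨c, hc⟩ := exists_isBigO_sub_const (ε := 1 / 2) (by norm_num) hd
    (((hg.isBigO (δ := 1 / 2) (by norm_num)).mul hz).congr (fun z => by rw [div_eq_mul_inv])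
      fun z => by norm_num)
  exact ⟨c, 1 / 2, by norm_num, by simpa using hc⟩

theorem HasLogExpansion.tendsto {f : ℝ → ℝ} {c : ℝ} (h : HasLogExpansion f (C c)) :
    Tendsto f (𝓝[<] 1) (𝓝 c) := by
  obtain ⟨ε, hε, h⟩ := h
  simp only [eval_C] at h
  exact tendsto_sub_nhds_zero_iff.1 (h.trans_tendsto (tendsto_one_sub_rpow hε))

/-! ### Shuffle regularization -/

theorem snoc_init_pred {r : ℕ} {κ : Fin (r + 1) → ℕ} (hκ : ∀ i, 0 < κ i) :
    κ = Fin.snoc (fun i : Fin r => κ i.castSucc) (κ (Fin.last r) - 1 + 1) := by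
  funext i
  have := hκ (Fin.last r)
  induction i using Fin.lastCases with
  | last => rw [Fin.snoc_last]; omega
  | cast i => rw [Fin.snoc_castSucc]

theorem exists_hasLogExpansion {r : ℕ} (κ : Fin r → ℕ) (hκ : ∀ i, 0 < κ i) :
    ∃ P, HasLogExpansion (Li κ) P := by
  induction r with
  | zero =>
    refine ⟨1, 1, one_pos, ?_⟩
    simpa [Li_depth_zero] using isBigO_zero _ _
  | succ r ih =>
    rw [snoc_init_pred hκ]
    generalize κ (Fin.last r) - 1 = l
    induction l with
    | zero =>
      obtain ⟨P, hP⟩ := ih (fun i => κ i.castSucc) fun i => hκ _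
      exact hP.exists_of_deriv_div_one_sub fun z hz => hasDerivAt_Li_snoc_one _ hz.1 hz.2
    | succ l ih' =>
      obtain ⟨P, hP⟩ := ih'
      obtain ⟨c, hc⟩ := hP.exists_const_of_deriv_div fun z hz =>
        hasDerivAt_Li_snoc _ (l + 1) hz.1 hz.2
      exact ⟨C c, hc⟩

theorem existsUnique_isShuffleRegPoly {r : ℕ} (κ : Fin r → ℕ) (hκ : ∀ i, 0 < κ i) :
    ∃! P, IsShuffleRegPoly κ P := by
  obtain ⟨P, hP⟩ := exists_hasLogExpansion κ hκ
  exact ⟨P, hP, fun Q hQ => HasLogExpansion.unique hQ hP⟩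

theorem hasLogExpansion_shufflePoly {r : ℕ} (κ : Fin r → ℕ) (hκ : ∀ i, 0 < κ i) :
    HasLogExpansion (Li κ) (shufflePoly κ) := by
  have h : ∃ P, IsShuffleRegPoly κ P := (existsUnique_isShuffleRegPoly κ hκ).exists
  rw [shufflePoly, dif_pos h]
  exact h.choose_spec

/-- When the last exponent is at least two, `Li κ` has a limit at `1`; the terms being
nonnegative, this forces the series at `1` to converge, to the same limit. -/
theorem summable_zetaTerm_and_hasLogExpansion {r : ℕ} (κ : Fin r → ℕ) (hκ : ∀ i, 0 < κ i)
    {l : ℕ} (hl : 1 ≤ l) :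
    Summable (zetaTerm (Fin.snoc κ (l + 1) : Fin (r + 1) → ℕ)) ∧
      HasLogExpansion (Li (Fin.snoc κ (l + 1) : Fin (r + 1) → ℕ))
        (C (zeta (Fin.snoc κ (l + 1) : Fin (r + 1) → ℕ))) := by
  have hpos : ∀ i, 0 < (Fin.snoc κ l : Fin (r + 1) → ℕ) i := fun i => by
    induction i using Fin.lastCases with
    | last => rw [Fin.snoc_last]; exact hl
    | cast i => rw [Fin.snoc_castSucc]; exact hκ i
  obtain ⟨P, hP⟩ := exists_hasLogExpansion _ hpos
  obtain ⟨c, hc⟩ := hP.exists_const_of_deriv_div fun z hz => hasDerivAt_Li_snoc _ l hz.1 hz.2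
  set κ' : Fin (r + 1) → ℕ := Fin.snoc κ (l + 1)
  have hterm : ∀ m, Tendsto (fun z => liTerm κ' z m) (𝓝[<] 1) (𝓝 (zetaTerm κ' m)) := fun m => by
    rw [← liTerm_one]
    have : Continuous fun z => liTerm κ' z m := by
      unfold liTerm
      fun_prop
    exact (this.tendsto 1).mono_left nhdsWithin_le_nhds
  have hnn : ∀ m, 0 ≤ zetaTerm κ' m := fun m => by
    rw [← liTerm_one]
    exact liTerm_nonneg _ zero_le_one _
  have hsum : Summable (zetaTerm κ') := by
    refine summable_of_sum_le (c := c) hnn fun s => ?_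
    refine le_of_tendsto_of_tendsto (tendsto_finsetSum s fun m _ => hterm m) hc.tendsto ?_
    refine eventually_mem_Ioo.mono fun z hz => ?_
    exact (summable_liTerm κ' hz.1.le hz.2).sum_le_tsum s fun m _ => liTerm_nonneg _ hz.1.le m
  refine ⟨hsum, ?_⟩
  have hlim : Tendsto (Li κ') (𝓝[<] 1) (𝓝 (zeta κ')) := by
    refine tendsto_tsum_of_dominated_convergence hsum hterm ?_
    refine eventually_mem_Ioo.mono fun z hz m => ?_
    rw [Real.norm_of_nonneg (liTerm_nonneg _ hz.1.le m), ← liTerm_one]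
    exact liTerm_mono _ hz.1.le hz.2.le m
  rwa [tendsto_nhds_unique hlim hc.tendsto]

/-! ### Sums over indices -/

theorem sum_indices_succ {M : Type*} [AddCommMonoid M] (r w : ℕ) (f : (Fin (r + 1) → ℕ) → M) :
    ∑ κ ∈ indices (r + 1) (w + 1), f κ =
      ∑ κ ∈ indices r w, f (Fin.snoc κ 1) +
        ∑ κ ∈ indices (r + 1) w,
          f (Fin.snoc (fun i : Fin r => κ i.castSucc) (κ (Fin.last r) + 1)) := by
  rw [← Finset.sum_filter_add_sum_filter_not _ fun κ => κ (Fin.last r) = 1]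
  congr 1
  · refine Finset.sum_nbij' (fun κ i => κ i.castSucc) (fun κ => Fin.snoc κ 1) ?_ ?_ ?_ ?_ ?_
    · intro κ hκ
      simp only [Finset.mem_filter, mem_indices, Fin.sum_univ_castSucc] at hκ ⊢
      exact ⟨by omega, fun i => hκ.1.2 _⟩
    · intro κ hκ
      simp only [Finset.mem_filter, mem_indices, Fin.sum_univ_castSucc, Fin.snoc_castSucc,
        Fin.snoc_last, Fin.forall_fin_succ'] at hκ ⊢
      exact ⟨⟨by omega, hκ.2, one_pos⟩, trivial⟩
    · intro κ hκ
      funext i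
      induction i using Fin.lastCases with
      | last => simp [(Finset.mem_filter.1 hκ).2]
      | cast i => simp
    · intro κ hκ
      simp
    · intro κ hκ
      congr 1
      funext i
      induction i using Fin.lastCases with
      | last => simp [(Finset.mem_filter.1 hκ).2]
      | cast i => simp
  · refine Finset.sum_nbij'
      (fun κ => Fin.snoc (fun i : Fin r => κ i.castSucc) (κ (Fin.last r) - 1))
      (fun κ => Fin.snoc (fun i : Fin r => κ i.castSucc) (κ (Fin.last r) + 1)) ?_ ?_ ?_ ?_ ?_
    · intro κ hκ
      simp only [Finset.mem_filter, mem_indices, Fin.sum_univ_castSucc, Fin.snoc_castSucc,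
        Fin.snoc_last, Fin.forall_fin_succ'] at hκ ⊢
      exact ⟨by omega, hκ.1.2.1, by omega⟩
    · intro κ hκ
      simp only [Finset.mem_filter, mem_indices, Fin.sum_univ_castSucc, Fin.snoc_castSucc,
        Fin.snoc_last, Fin.forall_fin_succ'] at hκ ⊢
      exact ⟨⟨by omega, hκ.2.1, by omega⟩, by omega⟩
    · intro κ hκ
      simp only [Fin.snoc_castSucc, Fin.snoc_last]
      exact (snoc_init_pred (mem_indices.1 (Finset.mem_filter.1 hκ).1).2).symm
    · intro κ hκ
      funext i
      induction i using Fin.lastCases <;> simp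
    · intro κ hκ
      simp only [Fin.snoc_castSucc, Fin.snoc_last]
      exact congrArg f (snoc_init_pred (mem_indices.1 (Finset.mem_filter.1 hκ).1).2)

theorem indices_self (r : ℕ) : indices r r = {fun _ => 1} := by
  ext κ
  rw [mem_indices, Finset.mem_singleton]
  constructor
  · rintro ⟨hs, hp⟩
    have h := (Finset.sum_eq_sum_iff_of_le (s := Finset.univ) (f := fun _ : Fin r => 1) (g := κ)
      fun i _ => hp i).1 (by simp [hs])
    exact funext fun i => (h i (Finset.mem_univ i)).symm
  · rintro rfl
    simp

theorem heightOne_succ (r k : ℕ) :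
    heightOne (r + 1) k = (Fin.snoc (fun _ : Fin r => 1) (k + 1) : Fin (r + 1) → ℕ) := by
  funext i
  induction i using Fin.lastCases with
  | last => simp [heightOne]
  | cast i => simp [heightOne, i.2.ne]

theorem heightOne_zero (r : ℕ) : heightOne r 0 = fun _ => 1 := by
  funext i
  simp [heightOne]

/-! ### The sum of the polylogarithms of given weight and depth -/

theorem eq_of_hasDerivAt_eq {f g d : ℝ → ℝ} (h0 : f 0 = g 0)
    (hf : ∀ b < 1, ContinuousOn f (Icc 0 b)) (hg : ∀ b < 1, ContinuousOn g (Icc 0 b))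
    (hfd : ∀ z ∈ Ioo (0 : ℝ) 1, HasDerivAt f (d z) z)
    (hgd : ∀ z ∈ Ioo (0 : ℝ) 1, HasDerivAt g (d z) z) {z : ℝ} (hz : 0 ≤ z) (hz1 : z < 1) :
    f z = g z := by
  rcases hz.eq_or_lt with rfl | hz
  · exact h0
  obtain ⟨c, hc, h⟩ := exists_hasDerivAt_eq_slope (fun y => f y - g y) (fun y => d y - d y) hz
    ((hf z hz1).sub (hg z hz1))
    fun y hy => (hfd y ⟨hy.1, hy.2.trans hz1⟩).sub (hgd y ⟨hy.1, hy.2.trans hz1⟩)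
  rw [sub_self, h0, sub_self, sub_zero, sub_zero, eq_comm, div_eq_zero_iff] at h
  exact sub_eq_zero.1 (h.resolve_right hz.ne')

/-- The divided power `(-log(1-z))^n / n!`. -/
noncomputable def logPow (n : ℕ) (z : ℝ) : ℝ := (-Real.log (1 - z)) ^ n / n.factorial

theorem logPow_zero (z : ℝ) : logPow 0 z = 1 := by simp [logPow]

theorem logPow_succ_zero (n : ℕ) : logPow (n + 1) 0 = 0 := by simp [logPow]

theorem hasDerivAt_logPow_succ (n : ℕ) {z : ℝ} (hz1 : z < 1) :
    HasDerivAt (logPow (n + 1)) (logPow n z / (1 - z)) z := by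
  refine (((hasDerivAt_neg_log_one_sub hz1).fun_pow (n + 1)).div_const _).congr_deriv ?_
  rw [logPow, Nat.factorial_succ]
  have h1 : 1 - z ≠ 0 := by linarith
  have h2 : (n : ℝ) + 1 ≠ 0 := by positivity
  push_cast
  field_simp

theorem continuousOn_logPow (n : ℕ) {b : ℝ} (hb : b < 1) : ContinuousOn (logPow n) (Icc 0 b) := by
  refine ContinuousOn.div_const ((ContinuousOn.log (by fun_prop) fun z hz => ?_).neg.pow n) _
  linarith [hz.2]

theorem Li_ones (r : ℕ) {z : ℝ} (hz : 0 ≤ z) (hz1 : z < 1) :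
    Li (fun _ : Fin r => 1) z = logPow r z := by
  induction r generalizing z with
  | zero => rw [Li_depth_zero, logPow_zero]
  | succ r ih =>
    refine eq_of_hasDerivAt_eq (d := fun z => logPow r z / (1 - z)) ?_
      (fun b hb => continuousOn_Li _ hb) (fun b hb => continuousOn_logPow _ hb) ?_
      (fun y hy => hasDerivAt_logPow_succ r hy.2) hz hz1
    · rw [Li_zero, logPow_succ_zero]
    · intro y hy
      have h := hasDerivAt_Li_snoc_one (fun _ : Fin r => 1) hy.1 hy.2
      rwa [ih hy.1.le hy.2, ← heightOne_succ r 0, heightOne_zero] at h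

/-- The sum of `Li κ` over all indices of depth `r` and weight `r + k`. -/
noncomputable def sumLi (r k : ℕ) (z : ℝ) : ℝ := ∑ κ ∈ indices r (r + k), Li κ z

/-- The right-hand side of the formula
`sumLi r k = ∑_{j < r} (-1)^j (-log(1-z))^(r-1-j) / (r-1-j)! · Li_{1, …, 1, k+1}`, with `j` ones in
the `j`-th term. -/
noncomputable def altSumLi (r k : ℕ) (z : ℝ) : ℝ :=
  ∑ j ∈ Finset.range r, (-1) ^ j * (logPow (r - 1 - j) z * Li (heightOne (j + 1) k) z)

theorem hasDerivAt_sumLi (r k : ℕ) {z : ℝ} (hz : 0 < z) (hz1 : z < 1) :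
    HasDerivAt (sumLi (r + 1) (k + 1)) (sumLi r (k + 1) z / (1 - z) + sumLi (r + 1) k z / z) z := by
  have hfun : sumLi (r + 1) (k + 1) = fun z =>
      ∑ κ ∈ indices r (r + (k + 1)), Li (Fin.snoc κ 1 : Fin (r + 1) → ℕ) z +
        ∑ κ ∈ indices (r + 1) (r + 1 + k),
          Li (Fin.snoc (fun i : Fin r => κ i.castSucc) (κ (Fin.last r) + 1) : Fin (r + 1) → ℕ)
            z := by
    funext z
    rw [sumLi, ← add_assoc, sum_indices_succ, show r + 1 + k = r + (k + 1) by omega]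
  rw [hfun, sumLi, sumLi, Finset.sum_div, Finset.sum_div]
  refine (HasDerivAt.fun_sum fun κ _ => hasDerivAt_Li_snoc_one κ hz hz1).add
    (HasDerivAt.fun_sum fun κ hκ => ?_)
  refine (hasDerivAt_Li_snoc _ _ hz hz1).congr_deriv ?_
  congr 2
  funext i
  induction i using Fin.lastCases <;> simp

theorem hasDerivAt_Li_heightOne (r k : ℕ) {z : ℝ} (hz : 0 < z) (hz1 : z < 1) :
    HasDerivAt (Li (heightOne (r + 1) (k + 1))) (Li (heightOne (r + 1) k) z / z) z := by
  rw [heightOne_succ, heightOne_succ]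
  exact hasDerivAt_Li_snoc _ _ hz hz1

theorem hasDerivAt_altSumLi (r k : ℕ) {z : ℝ} (hz : 0 < z) (hz1 : z < 1) :
    HasDerivAt (altSumLi (r + 1) (k + 1))
      (altSumLi r (k + 1) z / (1 - z) + altSumLi (r + 1) k z / z) z := by
  have hfun : ∀ k, altSumLi (r + 1) k = fun z =>
      ∑ j ∈ Finset.range r, (-1) ^ j *
        (logPow (r - 1 - j + 1) z * Li (heightOne (j + 1) k) z) +
      (-1) ^ r * Li (heightOne (r + 1) k) z := by
    intro k
    funext z
    rw [altSumLi, Finset.sum_range_succ, Nat.add_sub_cancel, Nat.sub_self, logPow_zero, one_mul]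
    congr 1
    refine Finset.sum_congr rfl fun j hj => ?_
    rw [show r - 1 - j + 1 = r - j by have := Finset.mem_range.1 hj; omega]
  rw [hfun, hfun k, altSumLi]
  refine ((HasDerivAt.fun_sum fun j _ => (((hasDerivAt_logPow_succ _ hz1).mul
    (hasDerivAt_Li_heightOne _ _ hz hz1)).const_mul _)).add
      ((hasDerivAt_Li_heightOne _ _ hz hz1).const_mul _)).congr_deriv ?_
  simp only [add_div, Finset.sum_div, ← add_assoc, ← Finset.sum_add_distrib]
  congr 1
  · exact Finset.sum_congr rfl fun j _ => by ring
  · ring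

/-- For `k = 0` both sides are powers of the logarithm, and the formula is the binomial theorem
for `(1 - 1)^(r+1)`. -/
theorem altSumLi_zero_right (r : ℕ) {z : ℝ} (hz : 0 ≤ z) (hz1 : z < 1) :
    altSumLi (r + 1) 0 z = logPow (r + 1) z := by
  simp only [altSumLi, heightOne_zero, Li_ones _ hz hz1]
  have h := add_pow (-1 : ℝ) 1 (r + 1)
  rw [neg_add_cancel, zero_pow r.succ_ne_zero, Finset.sum_range_succ'] at h
  have hterm : ∀ j ∈ Finset.range (r + 1), (-1 : ℝ) ^ j *
      (logPow (r + 1 - 1 - j) z * logPow (j + 1) z) =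
      -(logPow (r + 1) z * ((-1) ^ (j + 1) * 1 ^ (r + 1 - (j + 1)) * ((r + 1).choose (j + 1)))) := by
    intro j hj
    have hj' : j ≤ r := Nat.lt_succ_iff.1 (Finset.mem_range.1 hj)
    obtain ⟨i, rfl⟩ := Nat.exists_eq_add_of_le hj'
    rw [Nat.cast_choose ℝ (by omega), show j + i + 1 - 1 - j = i by omega,
      show j + i + 1 - (j + 1) = i by omega]
    unfold logPow
    have h1 : ((j + i + 1).factorial : ℝ) ≠ 0 := by positivity
    field_simp
    ring
  rw [Finset.sum_congr rfl hterm, Finset.sum_neg_distrib, ← Finset.mul_sum]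
  simp only [pow_zero, one_pow, mul_one, Nat.choose_zero_right, Nat.cast_one] at h ⊢
  linear_combination logPow (r + 1) z * h

theorem sumLi_eq_altSumLi (r k : ℕ) {z : ℝ} (hz : 0 ≤ z) (hz1 : z < 1) :
    sumLi (r + 1) k z = altSumLi (r + 1) k z := by
  induction k generalizing r z with
  | zero =>
    rw [altSumLi_zero_right r hz hz1, sumLi, add_zero, indices_self, Finset.sum_singleton,
      Li_ones _ hz hz1]
  | succ k ihk =>
    suffices h : ∀ r, ∀ z : ℝ, 0 ≤ z → z < 1 → sumLi r (k + 1) z = altSumLi r (k + 1) z from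
      h _ z hz hz1
    clear! r z
    intro r
    induction r with
    | zero =>
      intro z _ _
      have : indices 0 (0 + (k + 1)) = ∅ := by
        ext κ
        simp [mem_indices]
      rw [sumLi, altSumLi, this, Finset.sum_empty, Finset.range_zero, Finset.sum_empty]
    | succ r ihr =>
      intro z hz hz1
      refine eq_of_hasDerivAt_eq ?_ ?_ ?_ (fun y hy => hasDerivAt_sumLi r k hy.1 hy.2) ?_ hz hz1
      · simp [sumLi, altSumLi, Li_zero]
      · exact fun b hb => continuousOn_finsetSum _ fun κ _ => continuousOn_Li κ hb
      · exact fun b hb => continuousOn_finsetSum _ fun j _ =>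
          continuousOn_const.mul ((continuousOn_logPow _ hb).mul (continuousOn_Li _ hb))
      · intro y hy
        rw [ihr y hy.1.le hy.2, ihk r hy.1.le hy.2]
        exact hasDerivAt_altSumLi r k hy.1 hy.2

/-! ### The sum formula -/

theorem hasLogExpansion_altSumLi (r k : ℕ) :
    HasLogExpansion (altSumLi r (k + 1)) (∑ j ∈ Finset.range r,
      C ((-1) ^ j / ((r - 1 - j).factorial : ℝ)) * X ^ (r - 1 - j) *
        C (zeta (heightOne (j + 1) (k + 1)))) := by
  have hzeta : ∀ j, HasLogExpansion (Li (heightOne (j + 1) (k + 1)))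
      (C (zeta (heightOne (j + 1) (k + 1)))) := fun j => by
    rw [heightOne_succ]
    exact (summable_zetaTerm_and_hasLogExpansion _ (fun _ => one_pos) (Nat.succ_pos k)).2
  refine (HasLogExpansion.sum (Finset.range r) fun j _ => (hzeta j).eval_mul _).congr
    fun z _ => ?_
  refine Finset.sum_congr rfl fun j _ => ?_
  simp only [eval_mul, eval_C, eval_pow, eval_X, logPow]
  ring

end MZV

/-- The first three parts say that all the objects in the formula are well defined: the series
for `ζ(1, …, 1, k + 1)` and for `Li_κ(z)`, `0 ≤ z < 1`, converge, and every index `κ` in the sum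
has exactly one shuffle-regularized polynomial. The last part is the sum formula. -/
theorem theorem2 (r k : ℕ) (hr : 1 ≤ r) (hk : 1 ≤ k) :
    Summable (MZV.zetaTerm (MZV.heightOne r k)) ∧
    (∀ κ ∈ MZV.indices r (r + k), ∀ z : ℝ, 0 ≤ z → z < 1 → Summable (MZV.liTerm κ z)) ∧
    (∀ κ ∈ MZV.indices r (r + k), ∃! P : Polynomial ℝ, MZV.IsShuffleRegPoly κ P) ∧
    ∑ κ ∈ MZV.indices r (r + k), MZV.zetaSh κ
      = (-1 : ℝ) ^ (r - 1) * MZV.zeta (MZV.heightOne r k) := by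
  obtain ⟨r, rfl⟩ := Nat.exists_eq_add_of_le' hr
  obtain ⟨k, rfl⟩ := Nat.exists_eq_add_of_le' hk
  refine ⟨?_, fun κ _ z hz hz1 => MZV.summable_liTerm κ hz hz1,
    fun κ hκ => MZV.existsUnique_isShuffleRegPoly κ (MZV.mem_indices.1 hκ).2, ?_⟩
  · rw [MZV.heightOne_succ]
    exact (MZV.summable_zetaTerm_and_hasLogExpansion _ (fun _ => one_pos) (Nat.succ_pos k)).1
  · -- Both polynomials are the expansion of the sum of the `Li κ`; compare them at `T = 0`.
    have h1 : MZV.HasLogExpansion (MZV.sumLi (r + 1) (k + 1)) _ :=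
      MZV.HasLogExpansion.sum _ fun κ hκ =>
        MZV.hasLogExpansion_shufflePoly κ (MZV.mem_indices.1 hκ).2
    have h2 := (MZV.hasLogExpansion_altSumLi (r + 1) k).congr fun z hz =>
      (MZV.sumLi_eq_altSumLi r (k + 1) hz.1.le hz.2).symm
    have h := congrArg (Polynomial.eval 0) (h1.unique h2)
    rw [Polynomial.eval_finsetSum, Polynomial.eval_finsetSum, Finset.sum_range_succ,
      Finset.sum_eq_zero (s := Finset.range r)] at h
    · simpa [MZV.zetaSh] using h
    · intro j hj
      have hj' : r - j ≠ 0 := by have := Finset.mem_range.1 hj; omega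
      simp [hj']
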